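/- **Theorem 3.1 (no non-trivial Killing potential).** Let $(M,g)$ be a connected smooth Riemannian manifold (finite-dimensional, without boundary, Hausdorff and second countable) that is complete, i.e. for every $p\in M$ the exponential map $\exp_p$ is defined on all of $T_pM$. Suppose that there is a constant $c>0$ with $\mathrm{Ric}\ge c\,g$, i.e. $\mathrm{Ric}(v,v)\ge c\,g(v,v)$ for all $x\in M$ and $v\in T_xM$. A Killing potential is a function $u\in C^2(M)$ whose gradient $\nabla u$ (defined by $g(\nabla u,X)=X(u)$) is a Killing field, i.e. $(\mathcal L_{\nabla u}g)(Y,Z)=0$ for all smooth vector fields $Y,Z$ on $M$, where $(\mathcal L_Xg)(Y,Z)=X(g(Y,Z))-g([X,Y],Z)-g(Y,[X,Z])$. Then $M$ admits no non-trivial Killing potential: every Killing potential $u\in C^2(M)$ is constant. -/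

import Mathlib

open Bundle
open scoped Manifold ContDiff

noncomputable section

namespace RiemannianGeometry

section Connection

variable {E : Type*} [NormedAddCommGroup E] [NormedSpace ℝ E]
  {H : Type*} [TopologicalSpace H] (I : ModelWithCorners ℝ E H)
  {M : Type*} [TopologicalSpace M] [ChartedSpace H M]
  [IsManifold I ∞ M] [RiemannianBundle (fun x : M ↦ TangentSpace I x)]

/-- The Koszul expression, i.e. twice `⟨∇_X Y, Z⟩` at `x` for the Riemannian connection `∇`. -/
def koszul (X Y Z : Π x : M, TangentSpace I x) (x : M) : ℝ :=
  mvfderiv I (fun y ↦ inner ℝ (Y y) (Z y)) x (X x)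
  + mvfderiv I (fun y ↦ inner ℝ (X y) (Z y)) x (Y x)
  - mvfderiv I (fun y ↦ inner ℝ (X y) (Y y)) x (Z x)
  + inner ℝ (VectorField.mlieBracket I X Y x) (Z x)
  - inner ℝ (VectorField.mlieBracket I X Z x) (Y x)
  - inner ℝ (VectorField.mlieBracket I Y Z x) (X x)

variable [IsContMDiffRiemannianBundle I ∞ E (fun x : M ↦ TangentSpace I x)]

variable {I} in
theorem mdifferentiableAt_inner {X Y : Π x : M, TangentSpace I x} {x : M}
    (hX : MDiffAt (T% X) x) (hY : MDiffAt (T% Y) x) :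
    MDiffAt (fun y ↦ (inner ℝ (X y) (Y y) : ℝ)) x :=
  MDifferentiableAt.inner_bundle (IB := I) (F := E) (E := fun x : M ↦ TangentSpace I x)
    (b := fun y ↦ y) (v := X) (w := Y) hX hY

variable [FiniteDimensional ℝ E]

instance (x : M) : FiniteDimensional ℝ (TangentSpace I x) :=
  inferInstanceAs (FiniteDimensional ℝ E)

instance (x : M) : CompleteSpace (TangentSpace I x) := FiniteDimensional.complete ℝ _

variable {I}

theorem koszul_tensorial_left {Y Z : Π x : M, TangentSpace I x} {x : M}
    (hY : MDiffAt (T% Y) x) (hZ : MDiffAt (T% Z) x) :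
    TensorialAt I E (fun X ↦ koszul I X Y Z x) x where
  smul {f X} hf hX := by
    have h1 := mdifferentiableAt_inner hX hZ
    have h2 := mdifferentiableAt_inner hX hY
    simp [koszul, inner_smul_left, inner_add_left, inner_smul_right,
      VectorField.mlieBracket_smul_left hf hX, mvfderiv_fun_mul hf h1, mvfderiv_fun_mul hf h2]
    simp only [real_inner_comm]
    ring
  add {X X'} hX hX' := by
    have : CompleteSpace E := FiniteDimensional.complete ℝ _
    simp [koszul, inner_add_left, inner_add_right, VectorField.mlieBracket_add_left hX hX',
      mvfderiv_fun_add (mdifferentiableAt_inner hX hZ) (mdifferentiableAt_inner hX' hZ),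
      mvfderiv_fun_add (mdifferentiableAt_inner hX hY) (mdifferentiableAt_inner hX' hY)]
    ring

theorem koszul_tensorial_right {X Y : Π x : M, TangentSpace I x} {x : M}
    (hX : MDiffAt (T% X) x) (hY : MDiffAt (T% Y) x) :
    TensorialAt I E (fun Z ↦ koszul I X Y Z x) x where
  smul {f Z} hf hZ := by
    have h1 := mdifferentiableAt_inner hX hZ
    have h2 := mdifferentiableAt_inner hY hZ
    simp [koszul, inner_smul_left, inner_add_left, inner_smul_right,
      VectorField.mlieBracket_smul_right hf hZ,
      mvfderiv_fun_mul hf h1, mvfderiv_fun_mul hf h2]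
    simp only [real_inner_comm]
    ring
  add {Z Z'} hZ hZ' := by
    have : CompleteSpace E := FiniteDimensional.complete ℝ _
    simp [koszul, inner_add_left, inner_add_right, VectorField.mlieBracket_add_right hZ hZ',
      mvfderiv_fun_add (mdifferentiableAt_inner hX hZ) (mdifferentiableAt_inner hX hZ'),
      mvfderiv_fun_add (mdifferentiableAt_inner hY hZ) (mdifferentiableAt_inner hY hZ')]
    ring

open Classical in
variable (I) in
/-- The Riemannian connection `v ↦ ∇_v Y` at `x`, given by the Koszul formula
`2 ⟨∇_X Y, Z⟩ = koszul X Y Z` (junk value `0` if `Y` is not differentiable at `x`). -/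
def leviCivitaFun (Y : Π x : M, TangentSpace I x) (x : M) :
    TangentSpace I x →L[ℝ] TangentSpace I x :=
  if hY : MDiffAt (T% Y) x then
    LinearMap.toContinuousLinearMap
      { toFun := fun v ↦ (1 / 2 : ℝ) • (InnerProductSpace.toDual ℝ (TangentSpace I x)).symm
          (TensorialAt.mkHom₂ (fun X Z ↦ koszul I X Y Z x) x
            (fun _ hZ ↦ koszul_tensorial_left hY hZ) (fun _ hX ↦ koszul_tensorial_right hX hY) v)
        map_add' := fun v w ↦ by rw [map_add, map_add, smul_add]
        map_smul' := fun c v ↦ by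
          rw [map_smul, LinearIsometryEquiv.map_smulₛₗ, smul_comm]; simp }
  else 0

theorem inner_leviCivitaFun {X Y Z : Π x : M, TangentSpace I x} {x : M}
    (hX : MDiffAt (T% X) x) (hY : MDiffAt (T% Y) x) (hZ : MDiffAt (T% Z) x) :
    inner ℝ (leviCivitaFun I Y x (X x)) (Z x) = 1 / 2 * koszul I X Y Z x := by
  rw [leviCivitaFun, dif_pos hY]
  have := TensorialAt.mkHom₂_apply (Φ := fun X Z ↦ koszul I X Y Z x)
    (fun _ hZ ↦ koszul_tensorial_left hY hZ) (fun _ hX ↦ koszul_tensorial_right hX hY) hX hZ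
  rw [← this]
  change inner ℝ ((1 / 2 : ℝ) • (InnerProductSpace.toDual ℝ (TangentSpace I x)).symm _) (Z x) = _
  rw [inner_smul_left, InnerProductSpace.toDual_symm_apply]
  simp

theorem leviCivitaFun_isCovariantDerivativeOn :
    IsCovariantDerivativeOn E (leviCivitaFun (I := I) (M := M)) Set.univ where
  add {Y Y' x} hY hY' _ := by
    have : CompleteSpace E := FiniteDimensional.complete ℝ _
    ext v
    refine ext_inner_right ℝ fun w ↦ ?_
    have hv := FiberBundle.mdifferentiableAt_extend I E v
    have hw := FiberBundle.mdifferentiableAt_extend I E w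
    have h := inner_leviCivitaFun hv (mdifferentiableAt_add_section hY hY') hw
    have h1 := inner_leviCivitaFun hv hY hw
    have h2 := inner_leviCivitaFun hv hY' hw
    simp only [FiberBundle.extend_apply_self] at h h1 h2
    rw [_root_.add_apply, inner_add_left, h, h1, h2]
    simp [koszul, inner_add_left, inner_add_right, VectorField.mlieBracket_add_left hY hY',
      VectorField.mlieBracket_add_right hY hY',
      mvfderiv_fun_add (mdifferentiableAt_inner hY hw) (mdifferentiableAt_inner hY' hw),
      mvfderiv_fun_add (mdifferentiableAt_inner hv hY) (mdifferentiableAt_inner hv hY')]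
    ring
  leibniz {Y f x} hY hf _ := by
    ext v
    refine ext_inner_right ℝ fun w ↦ ?_
    have hv := FiberBundle.mdifferentiableAt_extend I E v
    have hw := FiberBundle.mdifferentiableAt_extend I E w
    have h := inner_leviCivitaFun hv (hf.smul_section hY) hw
    have h1 := inner_leviCivitaFun hv hY hw
    simp only [FiberBundle.extend_apply_self] at h h1
    have h2 := mdifferentiableAt_inner hY hw
    have h3 := mdifferentiableAt_inner hv hY
    rw [_root_.add_apply, inner_add_left, h, _root_.smul_apply,
      inner_smul_left, h1]
    simp [koszul, inner_smul_left, inner_add_left, inner_smul_right,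
      VectorField.mlieBracket_smul_left hf hY, VectorField.mlieBracket_smul_right hf hY,
      mvfderiv_fun_mul hf h2, mvfderiv_fun_mul hf h3]
    simp only [real_inner_comm]
    ring

variable (I M) in
/-- The Riemannian (Levi-Civita) connection of the Riemannian manifold `M`;
`leviCivita I M Y x (X x)` is `(∇_X Y)(x)`. -/
def leviCivita : CovariantDerivative I E (TangentSpace I : M → Type _) where
  toFun := leviCivitaFun I
  isCovariantDerivativeOnUniv := leviCivitaFun_isCovariantDerivativeOn

/-- The Riemannian connection is torsion free. -/
theorem leviCivita_torsion : haveI : CompleteSpace E := FiniteDimensional.complete ℝ _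
    (leviCivita I M).torsion = 0 := by
  have : CompleteSpace E := FiniteDimensional.complete ℝ _
  rw [CovariantDerivative.torsion_eq_zero_iff]
  intro X Y x hX hY
  refine ext_inner_right ℝ fun w ↦ ?_
  have hw := FiberBundle.mdifferentiableAt_extend I E w
  have h := inner_leviCivitaFun hX hY hw
  have h1 := inner_leviCivitaFun hY hX hw
  have e : VectorField.mlieBracket I Y X x = - VectorField.mlieBracket I X Y x :=
    VectorField.mlieBracket_swap_apply
  simp only [FiberBundle.extend_apply_self] at h h1
  change inner ℝ (leviCivitaFun I Y x (X x) - leviCivitaFun I X x (Y x)) w = _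
  rw [inner_sub_left, h, h1]
  simp only [koszul, real_inner_comm, e, inner_neg_left,
    FiberBundle.extend_apply_self]
  ring

/-- The Riemannian connection is metric. -/
theorem leviCivita_metric {X Y Z : Π x : M, TangentSpace I x} {x : M}
    (hX : MDiffAt (T% X) x) (hY : MDiffAt (T% Y) x) (hZ : MDiffAt (T% Z) x) :
    mvfderiv I (fun y ↦ (inner ℝ (Y y) (Z y) : ℝ)) x (X x) =
      inner ℝ (leviCivita I M Y x (X x)) (Z x) + inner ℝ (Y x) (leviCivita I M Z x (X x)) := by
  have h := inner_leviCivitaFun hX hY hZ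
  have h1 := inner_leviCivitaFun hX hZ hY
  have e : VectorField.mlieBracket I Y Z x = - VectorField.mlieBracket I Z Y x :=
    VectorField.mlieBracket_swap_apply
  change _ = inner ℝ (leviCivitaFun I Y x (X x)) (Z x) + inner ℝ (Y x) (leviCivitaFun I Z x (X x))
  rw [real_inner_comm _ (Y x), h, h1]
  simp only [koszul, e, inner_neg_left]
  simp only [real_inner_comm]
  ring

variable (I) in
/-- The Riemann curvature `R(X, Y)Z = ∇_X ∇_Y Z - ∇_Y ∇_X Z - ∇_[X, Y] Z`. -/
def curvature (X Y Z : Π x : M, TangentSpace I x) (x : M) : TangentSpace I x :=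
  leviCivita I M (fun y ↦ leviCivita I M Z y (Y y)) x (X x)
    - leviCivita I M (fun y ↦ leviCivita I M Z y (X y)) x (Y x)
    - leviCivita I M Z x (VectorField.mlieBracket I X Y x)

variable (I) in
/-- The Ricci tensor `Ric(v, w) = tr (z ↦ R(z, v)w) = ∑ i, ⟨R(eᵢ, v)w, eᵢ⟩` at `x`, where `(eᵢ)` is
an orthonormal basis of the tangent space at `x`. Since the curvature is a tensor, it can be computed
with any vector fields that are smooth near `x` and take the given values at `x`; here we use
`FiberBundle.extend`, the fields with constant coefficients in the trivialization at `x`. -/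
def ricci (x : M) (v w : TangentSpace I x) : ℝ :=
  ∑ i, inner ℝ
    (curvature I
      (FiberBundle.extend E (stdOrthonormalBasis ℝ (TangentSpace I x) i))
      (FiberBundle.extend E v) (FiberBundle.extend E w) x)
    (stdOrthonormalBasis ℝ (TangentSpace I x) i)

variable (I) in
/-- The velocity `γ'(t)` of a curve. -/
def velocity (γ : ℝ → M) (t : ℝ) : TangentSpace I (γ t) :=
  mfderiv 𝓘(ℝ, ℝ) I γ t (1 : ℝ)

variable (I) in
/-- The covariant derivative `∇_{γ'(t)} γ'(t)` of the velocity along the curve `γ`: in the frame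
`(Eᵢ)` of the trivialization of the tangent bundle at `γ t`, with `γ' = ∑ aᵢ Eᵢ`, it is
`∑ aᵢ'(t) Eᵢ + ∑ aᵢ(t) ∇_{γ'(t)} Eᵢ`. -/
def acceleration (γ : ℝ → M) (t : ℝ) : TangentSpace I (γ t) :=
  letI e := trivializationAt E (TangentSpace I : M → Type _) (γ t)
  e.symm (γ t) (deriv (fun s ↦ (e ⟨γ s, velocity I γ s⟩).2) t)
    + leviCivita I M (FiberBundle.extend E (velocity I γ t)) (γ t) (velocity I γ t)

variable (I) in
/-- `γ` is a geodesic on the open set `s` of times. -/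
def IsGeodesicOn (γ : ℝ → M) (s : Set ℝ) : Prop :=
  ContMDiffOn 𝓘(ℝ, ℝ) I ∞ γ s ∧ ∀ t ∈ s, acceleration I γ t = 0

variable (I) in
/-- The domain of the exponential map at `p`: the vectors `v` such that the geodesic `γ` with
`γ(0) = p` and `γ'(0) = v` is defined on `[0, 1]`. -/
def expDomain (p : M) : Set (TangentSpace I p) :=
  {v | ∃ (γ : ℝ → M) (s : Set ℝ), IsOpen s ∧ Set.Icc 0 1 ⊆ s ∧ IsGeodesicOn I γ s ∧
    (⟨γ 0, velocity I γ 0⟩ : TangentBundle I M) = ⟨p, v⟩}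

variable (I M) in
/-- `M` is complete: the exponential map is defined on all of each tangent space. -/
def IsGeodesicallyComplete : Prop :=
  ∀ p : M, expDomain I p = Set.univ

variable (I) in
/-- The gradient of `u`, characterized by `⟨∇u, v⟩ = du(v)`. -/
def gradient (u : M → ℝ) (x : M) : TangentSpace I x :=
  (InnerProductSpace.toDual ℝ (TangentSpace I x)).symm (mvfderiv I u x)

variable (I) in
/-- The Lie derivative of the metric,
`(𝓛_X g)(Y, Z) = X (g(Y, Z)) - g([X, Y], Z) - g(Y, [X, Z])`. -/
def lieDerivMetric (X Y Z : Π x : M, TangentSpace I x) (x : M) : ℝ :=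
  mvfderiv I (fun y ↦ (inner ℝ (Y y) (Z y) : ℝ)) x (X x)
    - inner ℝ (VectorField.mlieBracket I X Y x) (Z x)
    - inner ℝ (Y x) (VectorField.mlieBracket I X Z x)

variable (I) in
/-- A (`C^1`) vector field `X` is Killing if `𝓛_X g = 0`. -/
def IsKilling (X : Π x : M, TangentSpace I x) : Prop :=
  CMDiff 1 (T% X) ∧ ∀ Y Z : Π x : M, TangentSpace I x, CMDiff ∞ (T% Y) → CMDiff ∞ (T% Z) →
    ∀ x, lieDerivMetric I X Y Z x = 0

variable (I) in
/-- A `C^2` function `u` is a Killing potential if its gradient is a Killing vector field. -/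
def IsKillingPotential (u : M → ℝ) : Prop :=
  CMDiff 2 u ∧ IsKilling I (gradient I u)

end Connection

end RiemannianGeometry

end

/-! Let N = ∇u. By metricity and torsion-freeness of the connection, the Killing equation for N says
that Y, Z ↦ ⟨∇_Y N, Z⟩ is skew. Since N is a gradient, this form is the Hessian of u, hence
symmetric. So it vanishes and N is parallel (`IsKillingPotential.leviCivita_gradient_eq_zero`).

For parallel N, differentiating ⟨N, Z⟩ only ever hits Z, so the identity [X, Y]f = XYf - YXf for f =
⟨N, Z⟩ reads ⟨N, R(X, Y)Z⟩ = 0 (`inner_curvature_eq_zero_of_parallel`). Skew-adjointness of R(X, Y)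
then gives Ric(N, N) = 0 (`ricci_self_eq_zero_of_parallel`). The bound Ric ≥ c g with c > 0 forces N
= 0, so du = 0, and u is constant because M is connected.

The delicate point is regularity: u is only C^2, so N is only C^1 and ⟨N, Z⟩ is not known to be C^2
beforehand. The commutator identity is therefore proved for functions satisfying
`TwiceMDifferentiableAt`, where the second derivative is required at one point only. -/

noncomputable section

namespace RiemannianGeometry

/-! ### Second derivatives and Lie brackets read in a chart. -/

section Chart

open Set Filter Topology VectorField

variable {E : Type*} [NormedAddCommGroup E] [NormedSpace ℝ E]
  {H : Type*} [TopologicalSpace H] {I : ModelWithCorners ℝ E H}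
  {M : Type*} [TopologicalSpace M] [ChartedSpace H M]

variable (I) in
/-- `f` is differentiable near `x`, with derivative (read in the chart at `x`) differentiable
at `x`. -/
def TwiceMDifferentiableAt (f : M → ℝ) (x : M) : Prop :=
  (∀ᶠ y in 𝓝 x, MDiffAt f y) ∧
    DifferentiableAt ℝ (fderiv ℝ (f ∘ (extChartAt I x).symm)) (extChartAt I x x)

variable (I) in
/-- The vector field `Z` read in the chart at `x`. -/
def chartField [IsManifold I 1 M] (x : M) (Z : Π y : M, TangentSpace I y) (z : E) : E :=
  mpullbackWithin 𝓘(ℝ, E) I (extChartAt I x).symm Z (range I) z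

theorem tendsto_extChartAt_symm (x : M) :
    Tendsto (extChartAt I x).symm (𝓝 (extChartAt I x x)) (𝓝 x) := by
  simpa using (continuousAt_extChartAt_symm (I := I) x).tendsto

variable [I.Boundaryless]

theorem mdifferentiableAt_iff_differentiableAt_comp_symm [IsManifold I 1 M] {F : Type*}
    [NormedAddCommGroup F] [NormedSpace ℝ F] {f : M → F} {x : M} :
    MDiffAt f x ↔ DifferentiableAt ℝ (f ∘ (extChartAt I x).symm) (extChartAt I x x) := by
  constructor
  · intro h
    have := h.differentiableWithinAt_writtenInExtChartAt
    simpa [writtenInExtChartAt, I.range_eq_univ, differentiableWithinAt_univ] using! this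
  · intro h
    have h2 : MDiffAt ((f ∘ (extChartAt I x).symm) ∘ extChartAt I x) x :=
      h.mdifferentiableAt.comp x (mdifferentiableAt_extChartAt (mem_chart_source H x))
    refine h2.congr_of_eventuallyEq ?_
    filter_upwards [extChartAt_source_mem_nhds (I := I) x] with y hy
    exact congrArg f ((extChartAt I x).left_inv hy).symm

theorem hasFDerivAt_comp_extChartAt_symm [IsManifold I 1 M] {f : M → ℝ} {x : M} {z : E}
    (hz : z ∈ (extChartAt I x).target) (hf : MDiffAt f ((extChartAt I x).symm z)) :
    ∃ A : E →L[ℝ] ℝ, HasFDerivAt (f ∘ (extChartAt I x).symm) A z ∧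
      ∀ v : E, A v = mvfderiv I f ((extChartAt I x).symm z)
        (mfderivWithin 𝓘(ℝ, E) I (extChartAt I x).symm (range I) z v) := by
  have h1 := (mdifferentiableWithinAt_extChartAt_symm hz).hasMFDerivWithinAt
  have h2 := hasMFDerivWithinAt_iff_hasFDerivWithinAt.1
    (hf.hasMFDerivAt.comp_hasMFDerivWithinAt z h1)
  exact ⟨_, h2.hasFDerivAt (by simp [I.range_eq_univ]), fun _ ↦ rfl⟩

theorem mvfderiv_apply_eq_fderiv_comp_symm {g : M → ℝ} {x : M} (hg : MDiffAt g x)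
    (v : TangentSpace I x) :
    mvfderiv I g x v = fderiv ℝ (g ∘ (extChartAt I x).symm) (extChartAt I x x) v := by
  rw [hg.mvfderiv, I.range_eq_univ, fderivWithin_univ]
  rfl

omit [I.Boundaryless] in
theorem chartField_self [IsManifold I 1 M] (x : M) (Z : Π y : M, TangentSpace I y) :
    chartField I x Z (extChartAt I x x) = Z x := by
  have h := mfderivWithin_extChartAt_symm_inverse_apply (I := I) (x := x)
    (Z ((extChartAt I x).symm (extChartAt I x x)))
  refine h.trans ?_
  rw [extChartAt_to_inv x]

theorem mlieBracket_eq_lieBracket_chartField [IsManifold I 1 M] (x : M)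
    (Y Z : Π y : M, TangentSpace I y) :
    mlieBracket I Y Z x =
      lieBracket ℝ (chartField I x Y) (chartField I x Z) (extChartAt I x x) := by
  have h : ∀ w : TangentSpace I x, (ContinuousLinearMap.id ℝ (TangentSpace I x)).inverse w = w :=
    fun w ↦ by rw [ContinuousLinearMap.inverse_id]; rfl
  rw [← mlieBracketWithin_univ, mlieBracketWithin_apply, mfderiv_extChartAt_self]
  refine (h _).trans ?_
  rw [preimage_univ, univ_inter, I.range_eq_univ, ← lieBracketWithin_univ]
  unfold chartField
  rw [I.range_eq_univ]

variable [CompleteSpace E]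

omit [CompleteSpace E] in
theorem mvfderiv_eq_fderiv_chartField [IsManifold I 1 M] {f : M → ℝ} {x : M} {z : E}
    (hz : z ∈ (extChartAt I x).target) (hf : MDiffAt f ((extChartAt I x).symm z))
    (Z : Π y : M, TangentSpace I y) :
    mvfderiv I f ((extChartAt I x).symm z) (Z ((extChartAt I x).symm z)) =
      fderiv ℝ (f ∘ (extChartAt I x).symm) z (chartField I x Z z) := by
  obtain ⟨A, hA, hA'⟩ := hasFDerivAt_comp_extChartAt_symm hz hf
  rw [hA.fderiv, hA']
  exact congrArg (mvfderiv I f ((extChartAt I x).symm z))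
    ((isInvertible_mfderivWithin_extChartAt_symm (I := I) hz).inverse_apply_eq.1 rfl)

omit [CompleteSpace E] in
theorem mvfderiv_comp_symm_eventuallyEq [IsManifold I 1 M] {f : M → ℝ} {x : M}
    (hf : ∀ᶠ y in 𝓝 x, MDiffAt f y) (Z : Π y : M, TangentSpace I y) :
    (fun y ↦ mvfderiv I f y (Z y)) ∘ (extChartAt I x).symm =ᶠ[𝓝 (extChartAt I x x)]
      fun z ↦ fderiv ℝ (f ∘ (extChartAt I x).symm) z (chartField I x Z z) := by
  filter_upwards [(tendsto_extChartAt_symm x).eventually hf, extChartAt_target_mem_nhds x]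
    with z hz hz'
  exact mvfderiv_eq_fderiv_chartField hz' hz Z

theorem differentiableAt_chartField [IsManifold I 1 M] [IsManifold I 2 M]
    {Z : Π y : M, TangentSpace I y} {x : M} (hZ : MDiffAt (T% Z) x) :
    DifferentiableAt ℝ (chartField I x Z) (extChartAt I x x) := by
  have := MDifferentiableWithinAt.differentiableWithinAt_mpullbackWithin_vectorField
    (s := univ) hZ.mdifferentiableWithinAt
  exact this.differentiableAt (by simp [I.range_eq_univ])

-- The tangent bundle is trivialized at `x` by the derivative of the chart at `x`, so a field
-- constant in the trivialization is constant in the chart.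
omit [I.Boundaryless] [CompleteSpace E] in
theorem chartField_extend [IsManifold I 1 M] {x : M} (v : TangentSpace I x) {z : E}
    (hz : z ∈ (extChartAt I x).target) :
    chartField I x (FiberBundle.extend E v) z = v := by
  have hy := (extChartAt I x).map_target hz
  rw [extChartAt_source] at hy
  refine (isInvertible_mfderivWithin_extChartAt_symm (I := I) hz).inverse_apply_eq.2 ?_
  have h := TangentBundle.symmL_trivializationAt (I := I) hy
  rw [(extChartAt I x).right_inv hz] at h
  have h2 : (trivializationAt E (TangentSpace I) x ⟨x, v⟩).2 = v := by
    simpa using! (tangentBundleCore I M).coordChange_self (achart H x) x (mem_chart_source H x) v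
  unfold FiberBundle.extend
  rw [h2]
  have h3 := (trivializationAt E (TangentSpace I) x).symmL_apply (R := ℝ)
    (b := (extChartAt I x).symm z) hy v
  exact h3.symm.trans <| congrArg (fun A : E →L[ℝ] TangentSpace I ((extChartAt I x).symm z) ↦ A v) h

-- Evaluation on a basis of `E` identifies `E →L[ℝ] F` with a finite power of `F`, where
-- differentiability is checked on each component.
omit [CompleteSpace E] in
theorem differentiableAt_clm_of_apply {G F : Type*} [NormedAddCommGroup G] [NormedSpace ℝ G]
    [NormedAddCommGroup F] [NormedSpace ℝ F] [FiniteDimensional ℝ E] {f : G → E →L[ℝ] F} {x : G}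
    (h : ∀ v, DifferentiableAt ℝ (fun z ↦ f z v) x) : DifferentiableAt ℝ f x := by
  let e₁ := ContinuousLinearEquiv.ofFinrankEq
    (Module.finrank_fin_fun (R := ℝ) (n := Module.finrank ℝ E)).symm
  let e₂ := (e₁.arrowCongr (1 : F ≃L[ℝ] F)).trans
    (ContinuousLinearEquiv.piRing (Fin (Module.finrank ℝ E)))
  rw [← Function.id_comp f, ← e₂.symm_comp_self]
  exact e₂.symm.differentiableAt.comp x (differentiableAt_pi.2 fun i ↦ h _)

namespace TwiceMDifferentiableAt

theorem mdifferentiableAt_mvfderiv [IsManifold I 1 M] [IsManifold I 2 M] {f : M → ℝ} {x : M}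
    {Z : Π y : M, TangentSpace I y}
    (hf : TwiceMDifferentiableAt I f x) (hZ : MDiffAt (T% Z) x) :
    MDiffAt (fun y ↦ mvfderiv I f y (Z y)) x := by
  rw [mdifferentiableAt_iff_differentiableAt_comp_symm]
  exact (hf.2.clm_apply (differentiableAt_chartField hZ)).congr_of_eventuallyEq
    (mvfderiv_comp_symm_eventuallyEq hf.1 Z)

/-- In the chart, YZf and ZYf share the term D²f(Y, Z) up to the order of its arguments, and what
remains of the difference is Df applied to the bracket. Symmetry of D²f at a point needs only that
Df exist nearby and be differentiable at that point. -/
theorem mvfderiv_mlieBracket [IsManifold I 1 M] [IsManifold I 2 M] {f : M → ℝ} {x : M}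
    {Y Z : Π y : M, TangentSpace I y}
    (hf : TwiceMDifferentiableAt I f x) (hY : MDiffAt (T% Y) x) (hZ : MDiffAt (T% Z) x) :
    mvfderiv I f x (mlieBracket I Y Z x) =
      mvfderiv I (fun y ↦ mvfderiv I f y (Z y)) x (Y x) -
      mvfderiv I (fun y ↦ mvfderiv I f y (Y y)) x (Z x) := by
  have second : ∀ {V W : Π y : M, TangentSpace I y}, MDiffAt (T% W) x →
      mvfderiv I (fun y ↦ mvfderiv I f y (W y)) x (V x) =
      fderiv ℝ (f ∘ (extChartAt I x).symm) (extChartAt I x x)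
        (fderiv ℝ (chartField I x W) (extChartAt I x x) (chartField I x V (extChartAt I x x))) +
      fderiv ℝ (fderiv ℝ (f ∘ (extChartAt I x).symm)) (extChartAt I x x)
        (chartField I x V (extChartAt I x x)) (chartField I x W (extChartAt I x x)) := by
    intro V W hW
    rw [mvfderiv_apply_eq_fderiv_comp_symm (hf.mdifferentiableAt_mvfderiv hW),
      (mvfderiv_comp_symm_eventuallyEq hf.1 W).fderiv_eq,
      fderiv_clm_apply hf.2 (differentiableAt_chartField hW), ← chartField_self x V]
    rfl
  have symm : fderiv ℝ (fderiv ℝ (f ∘ (extChartAt I x).symm)) (extChartAt I x x)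
        (chartField I x Y (extChartAt I x x)) (chartField I x Z (extChartAt I x x)) =
      fderiv ℝ (fderiv ℝ (f ∘ (extChartAt I x).symm)) (extChartAt I x x)
        (chartField I x Z (extChartAt I x x)) (chartField I x Y (extChartAt I x x)) := by
    refine second_derivative_symmetric_of_eventually (f := f ∘ (extChartAt I x).symm) ?_
      hf.2.hasFDerivAt _ _
    filter_upwards [(tendsto_extChartAt_symm x).eventually hf.1, extChartAt_target_mem_nhds x]
      with z hz hz'
    obtain ⟨A, hA, -⟩ := hasFDerivAt_comp_extChartAt_symm hz' hz
    exact hA.differentiableAt.hasFDerivAt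
  rw [mvfderiv_apply_eq_fderiv_comp_symm hf.1.self_of_nhds, second hZ, second hY, symm,
    mlieBracket_eq_lieBracket_chartField, lieBracket_eq]
  simp

omit [CompleteSpace E] in
theorem of_contMDiffAt [IsManifold I 2 M] {f : M → ℝ} {x : M} (hf : CMDiffAt 2 f x) :
    TwiceMDifferentiableAt I f x := by
  constructor
  · have : IsManifold I 1 M := .of_le (n := 2) one_le_two
    filter_upwards [(contMDiffAt_iff_contMDiffAt_nhds (by simp)).1 hf] with y hy
    exact hy.mdifferentiableAt two_ne_zero
  · have h : ContDiffAt ℝ 2 (f ∘ (extChartAt I x).symm) (extChartAt I x x) := by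
      have := (contMDiffAt_iff.1 hf).2
      simpa [I.range_eq_univ, contDiffWithinAt_univ] using! this
    exact (h.fderiv_right (m := 1) (by norm_num)).differentiableAt one_ne_zero

-- The extended fields are constant in the chart, so the hypothesis says that each directional
-- derivative of `f` read in the chart is differentiable at the point.
omit [CompleteSpace E] in
theorem of_extend [FiniteDimensional ℝ E] [IsManifold I 1 M] {f : M → ℝ} {x : M}
    (hf : ∀ᶠ y in 𝓝 x, MDiffAt f y)
    (h : ∀ v : TangentSpace I x, MDiffAt (fun y ↦ mvfderiv I f y (FiberBundle.extend E v y)) x) :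
    TwiceMDifferentiableAt I f x := by
  refine ⟨hf, differentiableAt_clm_of_apply fun v ↦ ?_⟩
  have h1 := mdifferentiableAt_iff_differentiableAt_comp_symm.1 (h v)
  refine h1.congr_of_eventuallyEq ?_
  filter_upwards [mvfderiv_comp_symm_eventuallyEq hf (FiberBundle.extend E (v : TangentSpace I x)),
    extChartAt_target_mem_nhds x] with z hz hz'
  rw [hz]
  exact congrArg _ (chartField_extend (v : TangentSpace I x) hz').symm

end TwiceMDifferentiableAt

end Chart

/-! ### Functions with zero differential, and differentiability of solutions of linear systems. -/

section Calculus

open Set Filter Topology VectorField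

variable {E : Type*} [NormedAddCommGroup E] [NormedSpace ℝ E]
  {H : Type*} [TopologicalSpace H] {I : ModelWithCorners ℝ E H}
  {M : Type*} [TopologicalSpace M] [ChartedSpace H M]

theorem exists_forall_eq_of_mvfderiv_eq_zero [I.Boundaryless] [IsManifold I 1 M] [ConnectedSpace M]
    {f : M → ℝ} (hf : ∀ x, MDiffAt f x) (h : ∀ x, mvfderiv I f x = 0) : ∃ a, ∀ x, f x = a := by
  have hloc : IsLocallyConstant f := by
    refine (IsLocallyConstant.iff_eventually_eq f).2 fun x ↦ ?_
    obtain ⟨r, hr, hball⟩ := Metric.mem_nhds_iff.1 (extChartAt_target_mem_nhds (I := I) x)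
    have hd : ∀ z ∈ Metric.ball (extChartAt I x x) r,
        HasFDerivAt (f ∘ (extChartAt I x).symm) (0 : E →L[ℝ] ℝ) z := by
      intro z hz
      obtain ⟨A, hA, hA'⟩ := hasFDerivAt_comp_extChartAt_symm (hball hz) (hf _)
      convert hA
      ext v
      rw [hA', h]
      rfl
    have hev := (continuousAt_extChartAt (I := I) x).eventually (Metric.ball_mem_nhds _ hr)
    filter_upwards [hev, extChartAt_source_mem_nhds (I := I) x] with y hy hy'
    have := Metric.isOpen_ball.is_const_of_fderiv_eq_zero
      (convex_ball (extChartAt I x x) r).isPreconnected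
      (fun z hz ↦ (hd z hz).differentiableAt.differentiableWithinAt)
      (fun z hz ↦ (hd z hz).fderiv) hy (Metric.mem_ball_self hr)
    simpa only [Function.comp_apply, (extChartAt I x).left_inv hy', extChartAt_to_inv] using! this
  obtain ⟨x₀⟩ := (inferInstance : Nonempty M)
  exact ⟨f x₀, fun x ↦ hloc.apply_eq_of_preconnectedSpace x x₀⟩

theorem mvfderiv_congr_of_eventuallyEq {f g : M → ℝ} {x : M} (h : f =ᶠ[𝓝 x] g)
    (v : TangentSpace I x) : mvfderiv I f x v = mvfderiv I g x v :=
  congrArg (fun A : TangentSpace I x →L[ℝ] ℝ ↦ A v) (h.mfderiv_eq (I := I) (I' := 𝓘(ℝ, ℝ)))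

theorem mdifferentiableAt_clm_of_apply [I.Boundaryless] [IsManifold I 1 M] [FiniteDimensional ℝ E]
    {F : Type*} [NormedAddCommGroup F] [NormedSpace ℝ F] {f : M → E →L[ℝ] F} {x : M}
    (h : ∀ v, MDiffAt (fun y ↦ f y v) x) : MDiffAt f x :=
  mdifferentiableAt_iff_differentiableAt_comp_symm.2 <| differentiableAt_clm_of_apply fun v ↦
    mdifferentiableAt_iff_differentiableAt_comp_symm.1 (h v)

/-- If a family of linear maps depends differentiably on the point and is invertible at `x`,
then a map is differentiable at `x` as soon as its image under the family is. -/
theorem mdifferentiableAt_of_clm_apply [CompleteSpace E] {F : Type*} [NormedAddCommGroup F]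
    [NormedSpace ℝ F] {G : M → E →L[ℝ] F} {a : M → E} {x : M} {e : E ≃L[ℝ] F} (he : e = G x)
    (hG : MDiffAt G x) (hGa : MDiffAt (fun y ↦ G y (a y)) x) : MDiffAt a x := by
  have dinv : MDiffAt (fun y ↦ (G y).inverse) x := by
    have h1 : DifferentiableAt ℝ
        (ContinuousLinearMap.inverse : (E →L[ℝ] F) → F →L[ℝ] E) (G x) := by
      rw [← he]
      exact (contDiffAt_map_inverse (n := 1) e).differentiableAt one_ne_zero
    exact h1.mdifferentiableAt.comp x hG
  refine (dinv.clm_apply hGa).congr_of_eventuallyEq ?_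
  -- Invertibility is an open condition, so near `x` the vector `a y` is recovered by applying the
  -- inverse of `G y`.
  have hnhds : range ((↑) : (E ≃L[ℝ] F) → E →L[ℝ] F) ∈ 𝓝 (G x) := by
    rw [← he]
    exact e.nhds
  filter_upwards [hG.continuousAt hnhds] with y hy
  obtain ⟨A, hA⟩ := hy
  simp [← hA]

/-- `E` and its dual have the same dimension, so injectivity makes `G x` invertible, and `a` solves
a linear system with differentiable data. -/
theorem mdifferentiableAt_of_bilin_apply [I.Boundaryless] [IsManifold I 1 M]
    [FiniteDimensional ℝ E] {G : M → E →L[ℝ] E →L[ℝ] ℝ} {a : M → E} {x : M}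
    (inj : Function.Injective (G x)) (hG : ∀ v w, MDiffAt (fun y ↦ G y v w) x)
    (hGa : ∀ w, MDiffAt (fun y ↦ G y (a y) w) x) : MDiffAt a x := by
  have : CompleteSpace E := FiniteDimensional.complete ℝ _
  have hrank : Module.finrank ℝ E = Module.finrank ℝ (E →L[ℝ] ℝ) := by
    rw [← (LinearMap.toContinuousLinearMap (𝕜 := ℝ) (E := E) (F' := ℝ)).finrank_eq]
    exact (Subspace.dual_finrank_eq (K := ℝ) (V := E)).symm
  exact mdifferentiableAt_of_clm_apply
    (e := (LinearEquiv.ofInjectiveOfFinrankEq (G x).toLinearMap inj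
      hrank).toContinuousLinearEquiv) (by ext v w; rfl)
    (mdifferentiableAt_clm_of_apply fun v ↦ mdifferentiableAt_clm_of_apply fun w ↦ hG v w)
    (mdifferentiableAt_clm_of_apply hGa)

end Calculus

/-! ### The Levi-Civita connection, curvature and parallel fields. -/

section LeviCivita

open Set Filter Topology VectorField

variable {E : Type*} [NormedAddCommGroup E] [NormedSpace ℝ E]
  {H : Type*} [TopologicalSpace H] {I : ModelWithCorners ℝ E H}
  {M : Type*} [TopologicalSpace M] [ChartedSpace H M]
  [IsManifold I ∞ M] [RiemannianBundle (fun x : M ↦ TangentSpace I x)]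
  [IsContMDiffRiemannianBundle I ∞ E (fun x : M ↦ TangentSpace I x)]
  [FiniteDimensional ℝ E]

omit [RiemannianBundle fun x : M ↦ TangentSpace I x]
  [IsContMDiffRiemannianBundle I ∞ E fun x : M ↦ TangentSpace I x] [FiniteDimensional ℝ E] in
theorem eventually_mdifferentiableAt_of_contMDiffAt {Z : Π x : M, TangentSpace I x} {x : M}
    (hZ : CMDiffAt 2 (T% Z) x) : ∀ᶠ y in 𝓝 x, MDiffAt (T% Z) y := by
  filter_upwards [(contMDiffAt_iff_contMDiffAt_nhds (by simp)).1 hZ] with y hy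
  exact hy.mdifferentiableAt two_ne_zero

variable [I.Boundaryless]

/-- A vector field is differentiable if its inner products with smooth vector fields are. -/
theorem mdifferentiableAt_of_inner {V : Π x : M, TangentSpace I x} {x : M}
    (h : ∀ W : Π x : M, TangentSpace I x, CMDiffAt 2 (T% W) x →
      MDiffAt (fun y ↦ (inner ℝ (V y) (W y) : ℝ)) x) : MDiffAt (T% V) x := by
  have : CompleteSpace E := FiniteDimensional.complete ℝ _
  have : IsManifold I 1 M := .of_le (n := ∞) (by exact_mod_cast le_top)
  obtain ⟨g, -, hg⟩ := (inferInstance : IsContMDiffRiemannianBundle I ∞ E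
    (fun x : M ↦ TangentSpace I x)).exists_contMDiff
  set t := trivializationAt E (TangentSpace I : M → Type _) x with ht
  have hx : x ∈ t.baseSet := mem_baseSet_trivializationAt E _ x
  have hframe : ∀ w : E, CMDiffAt 2 (T% (fun y ↦ t.symm y w)) x := by
    intro w
    have h := FiberBundle.contMDiffAt_extend (k := 2) I E (t.symm x w)
    have e : FiberBundle.extend E (t.symm x w) = fun y ↦ t.symm y w := by
      funext y
      simp only [FiberBundle.extend, ← ht, t.apply_mk_symm hx]
    rwa [e] at h
  -- `G` is the Gram form of the metric in the trivialization at `x`. It is nondegenerate by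
  -- positivity, so the coordinates of `V` are determined by its inner products with the frame
  -- fields.
  let G : M → E →L[ℝ] E →L[ℝ] ℝ := fun y ↦ (g y).bilinearComp (t.symmL ℝ y) (t.symmL ℝ y)
  have hG : ∀ {y}, y ∈ t.baseSet → ∀ v w, G y v w = inner ℝ (t.symm y v) (t.symm y w) := by
    intro y hy v w
    rw [hg, ← t.symmL_apply (R := ℝ) hy, ← t.symmL_apply (R := ℝ) hy]
    rfl
  have hbase : ∀ᶠ y in 𝓝 x, y ∈ t.baseSet := t.open_baseSet.mem_nhds hx
  rw [mdifferentiableAt_section]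
  refine mdifferentiableAt_of_bilin_apply (G := G) ?_ (fun v w ↦ ?_) (fun w ↦ ?_)
  · refine (injective_iff_map_eq_zero _).2 fun v hv ↦ ?_
    have h0 : t.symmL ℝ x v = 0 := by
      rw [t.symmL_apply hx, ← inner_self_eq_zero (𝕜 := ℝ), ← hG hx, hv]
      rfl
    rw [← t.continuousLinearMapAt_symmL hx (R := ℝ) v, h0, map_zero]
  · refine (mdifferentiableAt_inner ((hframe v).mdifferentiableAt two_ne_zero)
      ((hframe w).mdifferentiableAt two_ne_zero)).congr_of_eventuallyEq ?_
    filter_upwards [hbase] with y hy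
    exact hG hy v w
  · refine (h _ (hframe w)).congr_of_eventuallyEq ?_
    filter_upwards [hbase] with y hy
    rw [hG hy, t.symm_apply_apply_mk hy]

omit [FiniteDimensional ℝ E] [I.Boundaryless] in
theorem contMDiffAt_inner {Z W : Π x : M, TangentSpace I x} {x : M}
    (hZ : CMDiffAt 2 (T% Z) x) (hW : CMDiffAt 2 (T% W) x) :
    CMDiffAt 2 (fun y ↦ (inner ℝ (Z y) (W y) : ℝ)) x :=
  ContMDiffAt.inner_bundle (IB := I) (F := E) (E := fun x : M ↦ TangentSpace I x)
    (b := fun y ↦ y) (v := Z) (w := W) hZ hW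

omit [RiemannianBundle fun x : M ↦ TangentSpace I x]
  [IsContMDiffRiemannianBundle I ∞ E fun x : M ↦ TangentSpace I x] [I.Boundaryless] in
theorem mdifferentiableAt_mlieBracket {Z W : Π x : M, TangentSpace I x} {x : M}
    (hZ : CMDiffAt 2 (T% Z) x) (hW : CMDiffAt 2 (T% W) x) :
    MDiffAt (T% (mlieBracket I Z W)) x := by
  have : CompleteSpace E := FiniteDimensional.complete ℝ _
  have : IsManifold I ((2 : ℕ∞) + 1) M := .of_le (n := ∞) (by exact_mod_cast le_top)
  have : IsManifold I (minSmoothness ℝ 2) M := by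
    rw [minSmoothness_of_isRCLikeNormedField]
    infer_instance
  have h := ContMDiffAt.mlieBracket_vectorField (m := 1) (n := 2) hZ hW
    (by simp; norm_num)
  exact h.mdifferentiableAt (by simp)

/-- The covariant derivative of a `C^2` field along a `C^2` field is differentiable. -/
theorem mdifferentiableAt_leviCivita {Y Z : Π x : M, TangentSpace I x} {x : M}
    (hY : CMDiffAt 2 (T% Y) x) (hZ : CMDiffAt 2 (T% Z) x) :
    MDiffAt (T% (fun y ↦ leviCivita I M Z y (Y y))) x := by
  have : CompleteSpace E := FiniteDimensional.complete ℝ _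
  have twice : ∀ {V W : Π x : M, TangentSpace I x}, CMDiffAt 2 (T% V) x → CMDiffAt 2 (T% W) x →
      TwiceMDifferentiableAt I (fun y ↦ (inner ℝ (V y) (W y) : ℝ)) x :=
    fun hV hW ↦ .of_contMDiffAt (contMDiffAt_inner hV hW)
  refine mdifferentiableAt_of_inner fun W hW ↦ ?_
  have dY := hY.mdifferentiableAt two_ne_zero
  have dZ := hZ.mdifferentiableAt two_ne_zero
  have dW := hW.mdifferentiableAt two_ne_zero
  -- By the Koszul formula this is ⟨∇_Y Z, W⟩ near `x`. Its terms are derivatives of C^2 functions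
  -- along differentiable fields, and inner products with differentiable brackets.
  have hk : MDiffAt (fun y ↦ (1 / 2 : ℝ) * koszul I Y Z W y) x := by
    have h1 := (twice hZ hW).mdifferentiableAt_mvfderiv dY
    have h2 := (twice hY hW).mdifferentiableAt_mvfderiv dZ
    have h3 := (twice hY hZ).mdifferentiableAt_mvfderiv dW
    have h4 := mdifferentiableAt_inner (mdifferentiableAt_mlieBracket hY hZ) dW
    have h5 := mdifferentiableAt_inner (mdifferentiableAt_mlieBracket hY hW) dZ
    have h6 := mdifferentiableAt_inner (mdifferentiableAt_mlieBracket hZ hW) dY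
    exact mdifferentiableAt_const.mul (((((h1.add h2).sub h3).add h4).sub h5).sub h6)
  refine hk.congr_of_eventuallyEq ?_
  filter_upwards [eventually_mdifferentiableAt_of_contMDiffAt hY,
    eventually_mdifferentiableAt_of_contMDiffAt hZ,
    eventually_mdifferentiableAt_of_contMDiffAt hW] with y h1 h2 h3
  exact inner_leviCivitaFun h1 h2 h3

/-- The curvature operator `R(X, Y)` is skew-adjoint. -/
theorem inner_curvature_add_inner_curvature {X Y Z W : Π x : M, TangentSpace I x} {x : M}
    (hX : CMDiffAt 2 (T% X) x) (hY : CMDiffAt 2 (T% Y) x)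
    (hZ : CMDiffAt 2 (T% Z) x) (hW : CMDiffAt 2 (T% W) x) :
    (inner ℝ (curvature I X Y Z x) (W x) : ℝ) + inner ℝ (Z x) (curvature I X Y W x) = 0 := by
  have : CompleteSpace E := FiniteDimensional.complete ℝ _
  have dX := hX.mdifferentiableAt two_ne_zero
  have dY := hY.mdifferentiableAt two_ne_zero
  have dZ := hZ.mdifferentiableAt two_ne_zero
  have dW := hW.mdifferentiableAt two_ne_zero
  -- The two mixed terms are exchanged when U and V are, so they cancel in the commutator of X and Y
  -- on ⟨Z, W⟩ and only curvature terms survive.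
  have second : ∀ {U V : Π x : M, TangentSpace I x}, CMDiffAt 2 (T% U) x → CMDiffAt 2 (T% V) x →
      mvfderiv I (fun y ↦ mvfderiv I (fun y ↦ (inner ℝ (Z y) (W y) : ℝ)) y (V y)) x (U x) =
      inner ℝ (leviCivita I M (fun y ↦ leviCivita I M Z y (V y)) x (U x)) (W x)
        + inner ℝ (leviCivita I M Z x (V x)) (leviCivita I M W x (U x))
        + (inner ℝ (leviCivita I M Z x (U x)) (leviCivita I M W x (V x))
        + inner ℝ (Z x) (leviCivita I M (fun y ↦ leviCivita I M W y (V y)) x (U x))) := by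
    intro U V hU hV
    have dU := hU.mdifferentiableAt two_ne_zero
    have dVZ := mdifferentiableAt_leviCivita hV hZ
    have dVW := mdifferentiableAt_leviCivita hV hW
    have hev : (fun y ↦ mvfderiv I (fun y ↦ (inner ℝ (Z y) (W y) : ℝ)) y (V y)) =ᶠ[𝓝 x]
        fun y ↦ (inner ℝ (leviCivita I M Z y (V y)) (W y) : ℝ)
          + inner ℝ (Z y) (leviCivita I M W y (V y)) := by
      filter_upwards [eventually_mdifferentiableAt_of_contMDiffAt hV,
        eventually_mdifferentiableAt_of_contMDiffAt hZ,
        eventually_mdifferentiableAt_of_contMDiffAt hW] with y h1 h2 h3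
      exact leviCivita_metric h1 h2 h3
    rw [mvfderiv_congr_of_eventuallyEq hev,
      mvfderiv_fun_add (mdifferentiableAt_inner dVZ dW) (mdifferentiableAt_inner dZ dVW),
      _root_.add_apply, leviCivita_metric dU dVZ dW, leviCivita_metric dU dZ dVW]
  have hb := (TwiceMDifferentiableAt.of_contMDiffAt (contMDiffAt_inner hZ hW)).mvfderiv_mlieBracket
    dX dY
  rw [leviCivita_metric (mdifferentiableAt_mlieBracket hX hY) dZ dW, second hX hY,
    second hY hX] at hb
  simp only [curvature, inner_sub_left, inner_sub_right]
  linarith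

omit [IsManifold I ∞ M] [IsContMDiffRiemannianBundle I ∞ E fun x : M ↦ TangentSpace I x]
  [I.Boundaryless] in
theorem inner_gradient (u : M → ℝ) {x : M} (v : TangentSpace I x) :
    inner ℝ (gradient I u x) v = mvfderiv I u x v :=
  InnerProductSpace.toDual_symm_apply

omit [I.Boundaryless] in
theorem leviCivita_sub_leviCivita {X Y : Π x : M, TangentSpace I x} {x : M}
    (hX : MDiffAt (T% X) x) (hY : MDiffAt (T% Y) x) :
    leviCivita I M Y x (X x) - leviCivita I M X x (Y x) = mlieBracket I X Y x := by
  have : CompleteSpace E := FiniteDimensional.complete ℝ _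
  exact (CovariantDerivative.torsion_eq_zero_iff _).1 (leviCivita_torsion (I := I) (M := M)) hX hY

omit [I.Boundaryless] in
theorem lieDerivMetric_eq {X Y Z : Π x : M, TangentSpace I x} {x : M}
    (hX : MDiffAt (T% X) x) (hY : MDiffAt (T% Y) x) (hZ : MDiffAt (T% Z) x) :
    lieDerivMetric I X Y Z x =
      inner ℝ (leviCivita I M X x (Y x)) (Z x) + inner ℝ (Y x) (leviCivita I M X x (Z x)) := by
  rw [lieDerivMetric, leviCivita_metric hX hY hZ, ← leviCivita_sub_leviCivita hX hY,
    ← leviCivita_sub_leviCivita hX hZ, inner_sub_left, inner_sub_right]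
  ring

/-- The Hessian of a `C^2` function is symmetric. -/
theorem inner_leviCivita_gradient_comm {u : M → ℝ} {Y Z : Π x : M, TangentSpace I x} {x : M}
    (hu : CMDiffAt 2 u x) (hN : MDiffAt (T% (gradient I u)) x)
    (hY : MDiffAt (T% Y) x) (hZ : MDiffAt (T% Z) x) :
    (inner ℝ (leviCivita I M (gradient I u) x (Y x)) (Z x) : ℝ) =
      inner ℝ (leviCivita I M (gradient I u) x (Z x)) (Y x) := by
  have : CompleteSpace E := FiniteDimensional.complete ℝ _
  -- Writing Yu = ⟨∇u, Y⟩ and expanding by metricity, the terms with ∇_Y Z - ∇_Z Y = [Y, Z] cancel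
  -- and leave the symmetry.
  have hb := (TwiceMDifferentiableAt.of_contMDiffAt hu).mvfderiv_mlieBracket hY hZ
  simp only [← inner_gradient u] at hb
  rw [leviCivita_metric hY hN hZ, leviCivita_metric hZ hN hY, ← leviCivita_sub_leviCivita hY hZ,
    inner_sub_right] at hb
  linarith

omit [RiemannianBundle fun x : M ↦ TangentSpace I x]
  [IsContMDiffRiemannianBundle I ∞ E fun x : M ↦ TangentSpace I x] [I.Boundaryless] in
/-- Every tangent vector extends to a smooth vector field. -/
theorem exists_contMDiff_eq [T2Space M] [SigmaCompactSpace M] {x : M} (v : TangentSpace I x) :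
    ∃ Y : Π y : M, TangentSpace I y, CMDiff ∞ (T% Y) ∧ Y x = v := by
  -- Prescribing the value over `x` and nothing elsewhere is a convex condition in each fibre, so
  -- local solutions can be glued by a partition of unity.
  suffices h : ∃ s : Cₛ^∞⟮I; E, (fun y : M ↦ TangentSpace I y)⟯,
      ∀ y : M, s y ∈ {w : TangentSpace I y | ∀ h : y = x, w = h ▸ v} by
    obtain ⟨s, hs⟩ := h
    exact ⟨s, s.contMDiff, hs x rfl⟩
  refine exists_contMDiffSection_forall_mem_convex_of_local (n := (⊤ : ℕ∞)) I
    (F_fiber := E) (fun y : M ↦ TangentSpace I y) _ (fun y ↦ ?_) (fun y ↦ ?_)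
  · rcases eq_or_ne y x with rfl | h
    · convert convex_singleton (𝕜 := ℝ) v
      simp
    · convert convex_univ (𝕜 := ℝ) (E := TangentSpace I y)
      simp [h]
  · rcases eq_or_ne y x with rfl | h
    · obtain ⟨U, hU, hs⟩ := FiberBundle.exists_contMDiffOn_extend (k := ∞) I E v
      refine ⟨U, hU, _, hs, ?_⟩
      rintro z - rfl
      simp
    · obtain ⟨U, hU, hs⟩ :=
        FiberBundle.exists_contMDiffOn_extend (k := ∞) I E (0 : TangentSpace I y)
      exact ⟨U ∩ {x}ᶜ, inter_mem hU (isOpen_compl_singleton.mem_nhds h), _,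
        hs.mono inter_subset_left, fun z hz hzx ↦ (hz.2 hzx).elim⟩

/-- The gradient of a Killing potential is parallel. -/
theorem IsKillingPotential.leviCivita_gradient_eq_zero [T2Space M] [SigmaCompactSpace M]
    {u : M → ℝ} (hu : IsKillingPotential I u) (x : M) :
    leviCivita I M (gradient I u) x = 0 := by
  ext v
  refine ext_inner_right ℝ fun w ↦ ?_
  -- The Killing equation is tested only on globally smooth fields, so local extensions of `v` and
  -- `w` would not do.
  obtain ⟨Y, hY, rfl⟩ := exists_contMDiff_eq v
  obtain ⟨Z, hZ, rfl⟩ := exists_contMDiff_eq w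
  have dN := hu.2.1.mdifferentiableAt (x := x) one_ne_zero
  have dY := hY.mdifferentiableAt (x := x) (by simp)
  have dZ := hZ.mdifferentiableAt (x := x) (by simp)
  have h := hu.2.2 Y Z hY hZ x
  rw [lieDerivMetric_eq dN dY dZ, real_inner_comm _ (Y x),
    ← inner_leviCivita_gradient_comm hu.1.contMDiffAt dN dY dZ] at h
  rw [_root_.zero_apply, inner_zero_left]
  linarith

/-- The curvature takes values orthogonal to a parallel field. -/
theorem inner_curvature_eq_zero_of_parallel {N X Y Z : Π x : M, TangentSpace I x} {x : M}
    (hN : MDiff (T% N)) (hN' : ∀ y, leviCivita I M N y = 0)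
    (hX : CMDiffAt 2 (T% X) x) (hY : CMDiffAt 2 (T% Y) x) (hZ : CMDiffAt 2 (T% Z) x) :
    (inner ℝ (N x) (curvature I X Y Z x) : ℝ) = 0 := by
  have : CompleteSpace E := FiniteDimensional.complete ℝ _
  have : IsManifold I 1 M := .of_le (n := ∞) (by exact_mod_cast le_top)
  have first : ∀ {U V : Π x : M, TangentSpace I x} {y : M}, MDiffAt (T% U) y → MDiffAt (T% V) y →
      mvfderiv I (fun y ↦ (inner ℝ (N y) (V y) : ℝ)) y (U y) =
        inner ℝ (N y) (leviCivita I M V y (U y)) := by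
    intro U V y hU hV
    rw [leviCivita_metric hU (hN y) hV, hN', _root_.zero_apply, inner_zero_left, zero_add]
  have first' : ∀ {U : Π x : M, TangentSpace I x}, CMDiffAt 2 (T% U) x →
      (fun y ↦ mvfderiv I (fun y ↦ (inner ℝ (N y) (Z y) : ℝ)) y (U y)) =ᶠ[𝓝 x]
        fun y ↦ (inner ℝ (N y) (leviCivita I M Z y (U y)) : ℝ) := by
    intro U hU
    filter_upwards [eventually_mdifferentiableAt_of_contMDiffAt hU,
      eventually_mdifferentiableAt_of_contMDiffAt hZ] with y h1 h2
    exact first h1 h2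
  -- The derivative ⟨N, ∇_U Z⟩ contains no derivative of N, so it is again differentiable although N
  -- is only assumed differentiable once.
  have twice : TwiceMDifferentiableAt I (fun y ↦ (inner ℝ (N y) (Z y) : ℝ)) x := by
    refine .of_extend ?_ fun v ↦ ?_
    · filter_upwards [eventually_mdifferentiableAt_of_contMDiffAt hZ] with y hy
      exact mdifferentiableAt_inner (hN y) hy
    · have hv := FiberBundle.contMDiffAt_extend (k := 2) I E v
      exact (mdifferentiableAt_inner (hN x) (mdifferentiableAt_leviCivita hv hZ)
        ).congr_of_eventuallyEq (first' hv)
  have dX := hX.mdifferentiableAt two_ne_zero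
  have dY := hY.mdifferentiableAt two_ne_zero
  have dZ := hZ.mdifferentiableAt two_ne_zero
  have second : ∀ {U V : Π x : M, TangentSpace I x}, CMDiffAt 2 (T% U) x → CMDiffAt 2 (T% V) x →
      mvfderiv I (fun y ↦ mvfderiv I (fun y ↦ (inner ℝ (N y) (Z y) : ℝ)) y (V y)) x (U x) =
      inner ℝ (N x) (leviCivita I M (fun y ↦ leviCivita I M Z y (V y)) x (U x)) := by
    intro U V hU hV
    rw [mvfderiv_congr_of_eventuallyEq (first' hV)]
    exact first (hU.mdifferentiableAt two_ne_zero) (mdifferentiableAt_leviCivita hV hZ)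
  have hb := twice.mvfderiv_mlieBracket dX dY
  rw [first (mdifferentiableAt_mlieBracket hX hY) dZ, second hX hY, second hY hX] at hb
  simp only [curvature, inner_sub_right]
  linarith

/-- The extension of `N x` used by `ricci` need not be parallel. Skew-adjointness turns ⟨R(eᵢ, N)N,
eᵢ⟩ into -⟨N, R(eᵢ, N)eᵢ⟩, where the outer N enters only through its value at `x` and can be read as
the parallel field itself. -/
theorem ricci_self_eq_zero_of_parallel {N : Π x : M, TangentSpace I x}
    (hN : MDiff (T% N)) (hN' : ∀ y, leviCivita I M N y = 0) (x : M) :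
    ricci I x (N x) (N x) = 0 := by
  refine Finset.sum_eq_zero fun i _ ↦ ?_
  have h : ∀ v : TangentSpace I x, CMDiffAt 2 (T% (FiberBundle.extend E v)) x :=
    fun v ↦ FiberBundle.contMDiffAt_extend (k := 2) I E v
  have h1 := inner_curvature_add_inner_curvature (h (stdOrthonormalBasis ℝ (TangentSpace I x) i))
    (h (N x)) (h (N x)) (h (stdOrthonormalBasis ℝ (TangentSpace I x) i))
  have h2 := inner_curvature_eq_zero_of_parallel hN hN'
    (h (stdOrthonormalBasis ℝ (TangentSpace I x) i)) (h (N x))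
    (h (stdOrthonormalBasis ℝ (TangentSpace I x) i))
  simp only [FiberBundle.extend_apply_self] at h1
  rwa [h2, add_zero] at h1

end LeviCivita

end RiemannianGeometry

end

open RiemannianGeometry in
theorem theorem3p1
    {E : Type*} [NormedAddCommGroup E] [NormedSpace ℝ E] [FiniteDimensional ℝ E]
    {M : Type*} [TopologicalSpace M] [T2Space M] [SecondCountableTopology M] [ConnectedSpace M]
    [ChartedSpace E M] [IsManifold 𝓘(ℝ, E) ∞ M]
    [RiemannianBundle (fun x : M ↦ TangentSpace 𝓘(ℝ, E) x)]
    [IsContMDiffRiemannianBundle 𝓘(ℝ, E) ∞ E (fun x : M ↦ TangentSpace 𝓘(ℝ, E) x)]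
    (hM : IsGeodesicallyComplete 𝓘(ℝ, E) M)
    (c : ℝ) (hc : 0 < c)
    (hRic : ∀ (x : M) (v : TangentSpace 𝓘(ℝ, E) x), c * inner ℝ v v ≤ ricci 𝓘(ℝ, E) x v v) :
    ¬ ∃ u : M → ℝ, IsKillingPotential 𝓘(ℝ, E) u ∧ ¬ ∃ a : ℝ, ∀ x, u x = a := by
  rintro ⟨u, hu, hconst⟩
  -- With second countability this gives σ-compactness, which the partition of unity requires.
  have : LocallyCompactSpace M := Manifold.locallyCompact_of_finiteDimensional 𝓘(ℝ, E)
  refine hconst (exists_forall_eq_of_mvfderiv_eq_zero (I := 𝓘(ℝ, E))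
    (fun x ↦ hu.1.mdifferentiableAt two_ne_zero) fun x ↦ ?_)
  have h0 := ricci_self_eq_zero_of_parallel (hu.2.1.mdifferentiable one_ne_zero)
    hu.leviCivita_gradient_eq_zero x
  have h1 := hRic x (gradient 𝓘(ℝ, E) u x)
  rw [h0] at h1
  -- The Ricci bound now reads c|∇u|² ≤ 0.
  have h2 : gradient 𝓘(ℝ, E) u x = 0 :=
    real_inner_self_nonpos.1 (nonpos_of_mul_nonpos_right h1 hc)
  ext v
  rw [← inner_gradient, h2, inner_zero_left]
  rfl
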